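/- **Lower bound for labeling heuristics.** All graphs are finite, undirected, with positive integer edge weights $w(u,v)$ (and $w(u,v)=0$ if $uv$ is not an edge). *Labeling heuristics.* Let $C, L:\mathbb N\to\mathbb N$. A labeling heuristic with label length $L$ and range $\{0,\dots,C\}$ consists, for every $n$, of a map $f$ that assigns to each weighted graph $G$ on $n$ vertices and each vertex $v$ of $G$ a label $f_G(v)\in\{0,\dots,C(n)\}^{L(n)}$, and of one map $g:\{0,\dots,C(n)\}^{L(n)}\times\{0,\dots,C(n)\}^{L(n)}\to\{0,\dots,C(n)\}$, the same for all $G$. The heuristic function on $G$ is $h_G(s,t)=g(f_G(s),f_G(t))$. It is consistent on $G$ if $h_G(t,t)=0$ and $w(u,v)+h_G(v,t)-h_G(u,t)\ge 0$ for every vertex $t$ and every edge $(u,v)$ (in both orientations). The labeling heuristic is called consistent if it is consistent on every connected $n$-vertex graph $G$ with $\sum_{u,v}w(u,v)\le C(n)$ (sum over ordered pairs), for every $n$. *A\*.* On input $G,s,t$ and heuristic $h$, A\* starts with the scanned set $S=\emptyset$, $d(s)=0$ and $d(v)=\infty$ for $v\ne s$. While $t\notin S$, it chooses some $u\notin S$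 minimizing $d(u)+h(u,t)$ over the vertices outside $S$ (ties are broken arbitrarily), sets $d(v)=\min(d(v),d(u)+w(u,v))$ for all neighbours $v$ of $u$, and adds $u$ to $S$. The vertices scanned are those of the final set $S$. **Theorem.** There are absolute constants $H\in\mathbb N$ and $c>0$ such that the following holds. Let $0\le\alpha\le 1$, let $C(n)$ be polynomially bounded in $n$ with $C(n)\ge n^6$ for all large $n$, and let $L(n)=o(n^\alpha)$. Then for every consistent labeling heuristic with label length $L$ and range $\{0,\dots,C\}$ and for all sufficiently large $n$ there is a connected $n$-vertex weighted graph $G$ with $\sum_{u,v}w(u,v)\le C(n)$, consisting of a clique with leaves attached to its vertices, such that 1. every shortest path between any two vertices of $G$ has at most $H$ hops (edges), and 2. for every way of breaking ties, the number of vertices scanned by A\* on $G$ with heuristic $h_G$, averaged over all $n^2$ pairs $(s,t)$, is at least $c\,n^{1-\alpha}$. -/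

import Mathlib

namespace AStar

/-- A weighted undirected graph: a simple graph together with a symmetric weight function with
values in the non-negative integers that is positive on edges and `0` on non-adjacent pairs. -/
structure WeightedGraph (V : Type*) extends SimpleGraph V where
  weight : V → V → ℕ
  weight_symm : ∀ u v, weight u v = weight v u
  weight_pos : ∀ u v, Adj u v → 0 < weight u v
  weight_eq_zero : ∀ u v, ¬ Adj u v → weight u v = 0

namespace WeightedGraph

variable {V : Type*}

/-- The sum of the edge weights over all ordered pairs of vertices. -/
def totalWeight [Fintype V] (G : WeightedGraph V) : ℕ :=
  ∑ u, ∑ v, G.weight u v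

/-- The length of a walk: the sum of the weights of the edges it traverses. The number of hops
of a walk `p` is `p.length`. -/
def walkWeight (G : WeightedGraph V) {u v : V} (p : G.toSimpleGraph.Walk u v) : ℕ :=
  (p.darts.map fun e => G.weight e.fst e.snd).sum

/-- `p` is a shortest path from `u` to `v`. As all edge weights are positive, a walk of minimal
weight automatically repeats no vertex. -/
def IsShortest (G : WeightedGraph V) {u v : V} (p : G.toSimpleGraph.Walk u v) : Prop :=
  ∀ q : G.toSimpleGraph.Walk u v, G.walkWeight p ≤ G.walkWeight q

/-- Every shortest path between any pair of vertices has at most `H` hops. -/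
def ShortestPathsHaveHopsAtMost (G : WeightedGraph V) (H : ℕ) : Prop :=
  ∀ (u v : V) (p : G.toSimpleGraph.Walk u v), G.IsShortest p → p.length ≤ H

/-- The graph is a clique on a vertex set `K` with leaves attached to it: every vertex outside
`K` has exactly one neighbour, and this neighbour lies in `K`. -/
def IsCliqueWithLeaves (G : WeightedGraph V) : Prop :=
  ∃ K : Set V, G.toSimpleGraph.IsClique K ∧
    ∀ v, v ∉ K → ∃ a ∈ K, ∀ u, G.Adj v u ↔ u = a

/-- The heuristic `h` (where `h u t` estimates the distance from `u` to `t`) is consistent: the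
modified costs `w(u,v) + h(v,t) - h(u,t)` are non-negative, and `h(t,t) = 0`. -/
def IsConsistent (G : WeightedGraph V) (h : V → V → ℕ) : Prop :=
  (∀ t u v, G.Adj u v → h u t ≤ G.weight u v + h v t) ∧ ∀ t, h t t = 0

end WeightedGraph

/-- A labeling heuristic for `n`-vertex graphs with label length `L` and range `{0, …, C}`.
The labels of the vertices are computed from the whole weighted graph; the function `est`, which
turns two labels into an estimate, is the same for all graphs and sees nothing but the labels. -/
structure LabelingHeuristic (n C L : ℕ) where
  label : WeightedGraph (Fin n) → Fin n → (Fin L → Fin (C + 1))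
  est : (Fin L → Fin (C + 1)) → (Fin L → Fin (C + 1)) → Fin (C + 1)

/-- The heuristic function `h(s,t) = g(f(s), f(t))` on the graph `G`. -/
def LabelingHeuristic.heuristic {n C L : ℕ} (h : LabelingHeuristic n C L)
    (G : WeightedGraph (Fin n)) (s t : Fin n) : ℕ :=
  (h.est (h.label G s) (h.label G t) : ℕ)

/-- A state of the A* algorithm: the set of vertices scanned so far, and the tentative distances
from the source (`⊤` for infinity). -/
structure State (V : Type*) where
  scanned : Finset V
  d : V → ℕ∞

/-- The initial state for source `s`: nothing is scanned, `d(s) = 0`, and `d = ∞` elsewhere. -/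
def initState {V : Type*} [DecidableEq V] (s : V) : State V where
  scanned := ∅
  d := fun v => if v = s then 0 else ⊤

open Classical in
/-- The state after scanning `u`: all the edges at `u` are relaxed, and `u` is marked scanned. -/
noncomputable def scan {V : Type*} (G : WeightedGraph V) (u : V) (σ : State V) : State V where
  scanned := insert u σ.scanned
  d := fun v => if G.Adj u v then min (σ.d v) (σ.d u + (G.weight u v : ℕ∞)) else σ.d v

/-- One iteration of A* with destination `t`: as long as `t` is not scanned, some unscanned vertex
`u` that minimizes `d(u) + h(u,t)` among the unscanned vertices is scanned. Ties may be broken in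
any way. -/
inductive Step {V : Type*} (G : WeightedGraph V) (h : V → V → ℕ) (t : V) :
    State V → State V → Prop
  | scan (σ : State V) (u : V) (ht : t ∉ σ.scanned) (hu : u ∉ σ.scanned)
      (hmin : ∀ v, v ∉ σ.scanned → σ.d u + (h u t : ℕ∞) ≤ σ.d v + (h v t : ℕ∞)) :
      Step G h t σ (scan G u σ)

/-- `S` is the set of vertices scanned by a complete run of A* on `G` with heuristic `h` from
source `s` to destination `t`, under some way of breaking ties. -/
def Scans {V : Type*} [DecidableEq V] (G : WeightedGraph V) (h : V → V → ℕ) (s t : V)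
    (S : Finset V) : Prop :=
  ∃ σ : State V, Relation.ReflTransGen (Step G h t) (initState s) σ ∧
    t ∈ σ.scanned ∧ σ.scanned = S

end AStar

/-! Short labels cannot encode a rich table of distances, and A* pays for every underestimate. Take
`2 * r` hubs forming a clique and spread all vertices evenly over them, attached by edges of weight
`1`. The weights between the two halves of the hubs are `2 * M + w (a, b)` with `M = n ^ 3` and `w`
free; the offset makes the triangle inequality automatic.

Search: consistency caps an estimate between the clusters of `a` and `b` at `2 * M + w (a, b) + 2`
(`hubGraph_heuristic_le`), so an estimate that is not `Near` is too small by more than `2`. A vertex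
with such an estimate lies within `2` of every source in its cluster, so its key drops strictly
below the distance to the target and it is scanned under any tie-breaking (`mem_of_scans`).

Counting: one vertex per hub gives `2 * r` labels, about `2 * r * L * log C` bits, against `r ^ 2 *
log M` bits in `w`. For `r` a large enough multiple of `L`, some `w` leaves at least half of the
estimates far off for every choice of one index per half (`exists_pow_card_near_le`,
`label_count_lt`). An average search between the two halves then scans at least half a cluster. With
`r` of order `n ^ α`, clusters have order `n ^ (1 - α)`, and such pairs are a constant fraction of
all pairs (`le_sum_card_scans`). -/

namespace AStar

/-! ### Weights of walks -/

section Walk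

variable {V : Type*}

theorem walkWeight_cons (G : WeightedGraph V) {u v w : V} (h : G.Adj u v)
    (p : G.toSimpleGraph.Walk v w) :
    G.walkWeight (SimpleGraph.Walk.cons h p) = G.weight u v + G.walkWeight p := by
  simp [WeightedGraph.walkWeight]

theorem walkWeight_nil (G : WeightedGraph V) {u : V} :
    G.walkWeight (SimpleGraph.Walk.nil : G.toSimpleGraph.Walk u u) = 0 := by
  simp [WeightedGraph.walkWeight]

theorem walkWeight_append (G : WeightedGraph V) {u v w : V} (p : G.toSimpleGraph.Walk u v)
    (q : G.toSimpleGraph.Walk v w) :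
    G.walkWeight (p.append q) = G.walkWeight p + G.walkWeight q := by
  simp [WeightedGraph.walkWeight, SimpleGraph.Walk.darts_append]

theorem walkWeight_reverse (G : WeightedGraph V) {u v : V} (p : G.toSimpleGraph.Walk u v) :
    G.walkWeight p.reverse = G.walkWeight p := by
  induction p with
  | nil => simp
  | cons h p ih =>
    rw [SimpleGraph.Walk.reverse_cons, walkWeight_append, walkWeight_cons, walkWeight_cons,
      walkWeight_nil, ih, G.weight_symm]
    omega

theorem not_isShortest_backtrack (G : WeightedGraph V) {u v w : V} (h : G.Adj u v)
    (h' : G.Adj v u) (p : G.toSimpleGraph.Walk u w) :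
    ¬ G.IsShortest (SimpleGraph.Walk.cons h (SimpleGraph.Walk.cons h' p)) := by
  intro hs
  have := hs p
  rw [walkWeight_cons, walkWeight_cons] at this
  have := G.weight_pos _ _ h
  omega

theorem IsShortest.of_cons (G : WeightedGraph V) {u v w : V} {h : G.Adj u v}
    {p : G.toSimpleGraph.Walk v w} (hs : G.IsShortest (SimpleGraph.Walk.cons h p)) :
    G.IsShortest p := by
  intro q
  have := hs (SimpleGraph.Walk.cons h q)
  rw [walkWeight_cons, walkWeight_cons] at this
  omega

end Walk

/-! ### Cliques with leaves: distances, hops and consistent heuristics -/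

section HubGraph

variable {V : Type*} [DecidableEq V]

/-- The weight function of the graph `hubGraph`. -/
def hubWeight (hub : V → V) (W : V → V → ℕ) (u v : V) : ℕ :=
  if u = v then 0 else if hub u = u ∧ hub v = v then W u v
  else if hub u = v ∨ hub v = u then 1 else 0

/-- The graph in which the fixed points of `hub` form a clique with weights `W`, and every other
vertex `v` is a leaf attached to `hub v` by an edge of weight `1`. -/
def hubGraph (hub : V → V) (W : V → V → ℕ) (hW : ∀ a b, W a b = W b a) : WeightedGraph V where
  weight := hubWeight hub W
  Adj u v := 0 < hubWeight hub W u v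
  symm := ⟨fun u v h => by
    have : hubWeight hub W v u = hubWeight hub W u v := by
      simp only [hubWeight, eq_comm (a := v) (b := u), and_comm, or_comm, hW v u]
    rwa [this]⟩
  loopless := ⟨fun u h => by simp [hubWeight] at h⟩
  weight_symm u v := by
    simp only [hubWeight, eq_comm (a := v) (b := u), and_comm, or_comm, hW v u]
  weight_pos _ _ h := h
  weight_eq_zero _ _ h := Nat.eq_zero_of_not_pos h

variable {hub : V → V} {W : V → V → ℕ} {hW : ∀ a b, W a b = W b a} {M : ℕ}

theorem hubGraph_adj_iff {u v : V} :
    (hubGraph hub W hW).Adj u v ↔ 0 < (hubGraph hub W hW).weight u v := Iff.rfl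

theorem hubGraph_weight_hub {v : V} (hv : hub v ≠ v) :
    (hubGraph hub W hW).weight v (hub v) = 1 := by
  simp [hubGraph, hubWeight, hv, Ne.symm hv]

theorem hubGraph_weight_hub_hub (hid : ∀ v, hub (hub v) = hub v) {u v : V} (h : hub u ≠ hub v) :
    (hubGraph hub W hW).weight (hub u) (hub v) = W (hub u) (hub v) := by
  simp [hubGraph, hubWeight, h, hid]

theorem hubGraph_weight_of_hub {u v : V} (h : u ≠ v) (hu : hub u = u) (hv : hub v = v) :
    (hubGraph hub W hW).weight u v = W u v := by
  simp [hubGraph, hubWeight, h, hu, hv]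

theorem hubGraph_eq_hub_of_adj (hid : ∀ v, hub (hub v) = hub v) {u v : V} (hv : hub v ≠ v)
    (h : (hubGraph hub W hW).Adj v u) : u = hub v := by
  by_contra hne
  have h1 : hub u ≠ v := fun h1 => hv (by rw [← h1, hid])
  rw [hubGraph_adj_iff] at h
  simp [hubGraph, hubWeight, hv, h1, Ne.symm hne] at h

/-- Moving to the hub costs at most one step of weight `1`. -/
theorem hubGraph_hub_step (v : V) :
    v = hub v ∨ ((hubGraph hub W hW).Adj v (hub v) ∧ (hubGraph hub W hW).weight v (hub v) = 1) := by
  by_cases hv : hub v = v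
  · exact Or.inl hv.symm
  · refine Or.inr ⟨?_, hubGraph_weight_hub hv⟩
    rw [hubGraph_adj_iff, hubGraph_weight_hub hv]
    exact one_pos

theorem hubGraph_isCliqueWithLeaves (hid : ∀ v, hub (hub v) = hub v)
    (hpos : ∀ a b, a ≠ b → 0 < W a b) : (hubGraph hub W hW).IsCliqueWithLeaves := by
  refine ⟨{v | hub v = v}, ?_, ?_⟩
  · intro u hu v hv huv
    rw [hubGraph_adj_iff, hubGraph_weight_of_hub huv hu hv]
    exact hpos u v huv
  · intro v hv
    refine ⟨hub v, hid v, fun u => ⟨hubGraph_eq_hub_of_adj hid hv, ?_⟩⟩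
    rintro rfl
    exact ((hubGraph_hub_step (hub := hub) v).resolve_left (Ne.symm hv)).1

theorem hubGraph_exists_walk_hub (v : V) :
    ∃ p : (hubGraph hub W hW).toSimpleGraph.Walk v (hub v),
      (hubGraph hub W hW).walkWeight p ≤ 1 := by
  rcases hubGraph_hub_step (hub := hub) (hW := hW) v with h | ⟨h, h1⟩
  · rw [← h]
    exact ⟨.nil, by simp [walkWeight_nil]⟩
  · exact ⟨.cons h .nil, by simp [walkWeight_cons, walkWeight_nil, h1]⟩

theorem hubGraph_exists_walk (hid : ∀ v, hub (hub v) = hub v)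
    (hpos : ∀ a b, a ≠ b → 0 < W a b) {B : ℕ} (hB : ∀ a b, W a b ≤ B) (u v : V) :
    ∃ p : (hubGraph hub W hW).toSimpleGraph.Walk u v,
      (hubGraph hub W hW).walkWeight p ≤ B + 2 := by
  obtain ⟨p, hp⟩ := hubGraph_exists_walk_hub (hW := hW) u
  obtain ⟨q, hq⟩ := hubGraph_exists_walk_hub (hW := hW) v
  have : ∃ r : (hubGraph hub W hW).toSimpleGraph.Walk (hub u) (hub v),
      (hubGraph hub W hW).walkWeight r ≤ B := by
    by_cases h : hub u = hub v
    · rw [h]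
      exact ⟨.nil, by simp [walkWeight_nil]⟩
    · have hw := hubGraph_weight_hub_hub (hW := hW) hid h
      refine ⟨.cons ?_ .nil, ?_⟩
      · rw [hubGraph_adj_iff, hw]
        exact hpos _ _ h
      · rw [walkWeight_cons, walkWeight_nil, hw]
        exact hB _ _
  obtain ⟨r, hr⟩ := this
  refine ⟨(p.append r).append q.reverse, ?_⟩
  rw [walkWeight_append, walkWeight_append, walkWeight_reverse]
  omega

theorem hubGraph_connected [Nonempty V] (hid : ∀ v, hub (hub v) = hub v)
    (hpos : ∀ a b, a ≠ b → 0 < W a b) {B : ℕ} (hB : ∀ a b, W a b ≤ B) :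
    (hubGraph hub W hW).toSimpleGraph.Connected :=
  ⟨fun u v => let ⟨p, _⟩ := hubGraph_exists_walk (hW := hW) hid hpos hB u v; ⟨p⟩⟩

theorem hubGraph_totalWeight_le [Fintype V] {B : ℕ} (h1 : 1 ≤ B) (hB : ∀ a b, W a b ≤ B) :
    (hubGraph hub W hW).totalWeight ≤ Fintype.card V ^ 2 * B := by
  have hle : ∀ u v, (hubGraph hub W hW).weight u v ≤ B := by
    intro u v
    simp only [hubGraph, hubWeight]
    split_ifs
    exacts [Nat.zero_le _, hB _ _, h1, Nat.zero_le _]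
  calc (hubGraph hub W hW).totalWeight ≤ ∑ _u : V, ∑ _v : V, B :=
        Finset.sum_le_sum fun u _ => Finset.sum_le_sum fun v _ => hle u v
    _ = Fintype.card V ^ 2 * B := by simp; ring

/-- A shortest path with four or more edges would traverse two clique edges, costing at least `4 *
M`, while the direct route through the hubs costs less. -/
theorem hubGraph_hops (hid : ∀ v, hub (hub v) = hub v) (hM : 0 < M)
    (hlow : ∀ a b, a ≠ b → 2 * M ≤ W a b) (hup : ∀ a b, W a b + 3 ≤ 4 * M) :
    (hubGraph hub W hW).ShortestPathsHaveHopsAtMost 3 := by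
  have hpos : ∀ a b, a ≠ b → 0 < W a b := fun a b h => by have := hlow a b h; omega
  -- A leaf has a single neighbour, so it cannot be an inner vertex of a walk that does not
  -- backtrack.
  have mid : ∀ {x y z : V}, (hubGraph hub W hW).Adj x y → (hubGraph hub W hW).Adj y z → x ≠ z →
      hub y = y := by
    intro x y z h1 h2 hxz
    by_contra hy
    exact hxz ((hubGraph_eq_hub_of_adj hid hy h1.symm).trans
      (hubGraph_eq_hub_of_adj hid hy h2).symm)
  have big : ∀ {x y : V}, (hubGraph hub W hW).Adj x y → hub x = x → hub y = y →
      2 * M ≤ (hubGraph hub W hW).weight x y := by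
    intro x y h hx hy
    rw [hubGraph_weight_of_hub h.ne hx hy]
    exact hlow _ _ h.ne
  intro u v p hp
  match p, hp with
  | .nil, _ => simp
  | .cons _ .nil, _ => simp
  | .cons _ (.cons _ .nil), _ => simp
  | .cons _ (.cons _ (.cons _ .nil)), _ => simp
  | .cons (v := v₁) h₁ (.cons (v := v₂) h₂ (.cons (v := v₃) h₃ (.cons (v := v₄) h₄ p))), hp =>
    exfalso
    have n1 : u ≠ v₂ := by
      rintro rfl
      exact not_isShortest_backtrack _ _ _ _ hp
    have n2 : v₁ ≠ v₃ := by
      rintro rfl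
      exact not_isShortest_backtrack _ _ _ _ (IsShortest.of_cons _ hp)
    have n3 : v₂ ≠ v₄ := by
      rintro rfl
      exact not_isShortest_backtrack _ _ _ _ (IsShortest.of_cons _ (IsShortest.of_cons _ hp))
    have e1 := mid h₁ h₂ n1
    have e2 := mid h₂ h₃ n2
    have e3 := mid h₃ h₄ n3
    have b1 := big h₂ e1 e2
    have b2 := big h₃ e2 e3
    -- The two leaf edges bring the competing route to at most `4 * M - 3 + 2`, below the two clique
    -- edges.
    obtain ⟨q, hq⟩ := hubGraph_exists_walk (hW := hW) hid hpos
      (B := 4 * M - 3) (fun a b => by have := hup a b; omega) u v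
    have := hp q
    simp only [walkWeight_cons] at this
    omega

/-- The length of a walk is at least the weight between the hubs of its ends. -/
theorem hubGraph_le_walkWeight (hid : ∀ v, hub (hub v) = hub v) (hself : ∀ a, W a a = 0)
    (htri : ∀ a b c, W a c ≤ W a b + W b c) {u v : V}
    (p : (hubGraph hub W hW).toSimpleGraph.Walk u v) :
    W (hub u) (hub v) ≤ (hubGraph hub W hW).walkWeight p := by
  induction p with
  | nil => simp [hself]
  | @cons u x v h p ih =>
    rw [walkWeight_cons]
    refine (htri _ (hub x) _).trans (Nat.add_le_add ?_ ih)
    -- Projecting the walk to the hubs keeps clique edges and collapses each leaf edge to a point.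
    by_cases hu : hub u = u
    · by_cases hx : hub x = x
      · rw [hubGraph_weight_of_hub h.ne hu hx, hu, hx]
      · have := hubGraph_eq_hub_of_adj hid hx h.symm
        rw [← this, hu, hself]
        exact Nat.zero_le _
    · have := hubGraph_eq_hub_of_adj hid hu h
      rw [this, hid, hself]
      exact Nat.zero_le _

/-- A consistent heuristic is at most the length of the route through the hubs. -/
theorem hubGraph_heuristic_le (hid : ∀ v, hub (hub v) = hub v)
    (hpos : ∀ a b, a ≠ b → 0 < W a b) {h : V → V → ℕ}
    (hc : (hubGraph hub W hW).IsConsistent h) {u v : V} (huv : hub u ≠ hub v) :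
    h u v ≤ W (hub u) (hub v) + 2 := by
  have h1 : h u v ≤ 1 + h (hub u) v := by
    rcases hubGraph_hub_step (hub := hub) (hW := hW) u with e | ⟨ha, hw⟩
    · rw [← e]; omega
    · have := hc.1 v _ _ ha
      omega
  have h3 : h (hub v) v ≤ 1 := by
    rcases hubGraph_hub_step (hub := hub) (hW := hW) v with e | ⟨ha, hw⟩
    · rw [← e, hc.2]; omega
    · have := hc.1 v _ _ ha.symm
      rw [WeightedGraph.weight_symm, hw, hc.2] at this
      omega
  have hw := hubGraph_weight_hub_hub (hW := hW) hid huv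
  have h2 := hc.1 v (hub u) (hub v) (by
    rw [hubGraph_adj_iff, hw]
    exact hpos _ _ huv)
  omega

end HubGraph

/-! ### Runs of A* -/

section Search

variable {V : Type*} {G : WeightedGraph V} {h : V → V → ℕ} {s t : V}

theorem d_scan_le (u : V) (σ : State V) (v : V) : (scan G u σ).d v ≤ σ.d v := by
  simp only [scan]
  split_ifs
  exacts [min_le_left _ _, le_rfl]

theorem d_scan_le_of_adj {u v : V} (σ : State V) (huv : G.Adj u v) :
    (scan G u σ).d v ≤ σ.d u + (G.weight u v : ℕ∞) := by
  simp [scan, huv]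

theorem mem_scan_scanned {u v : V} {σ : State V} :
    v ∈ (scan G u σ).scanned ↔ v = u ∨ v ∈ σ.scanned := by
  simp [scan]

variable [DecidableEq V]

/-- Tentative distances are at least the length of some walk from the source. -/
theorem exists_walk_le_d {σ : State V} (hσ : Relation.ReflTransGen (Step G h t) (initState s) σ)
    (v : V) : σ.d v = ⊤ ∨ ∃ p : G.toSimpleGraph.Walk s v, (G.walkWeight p : ℕ∞) ≤ σ.d v := by
  induction hσ generalizing v with
  | refl =>
    by_cases hv : v = s
    · subst hv
      exact Or.inr ⟨.nil, by simp [WeightedGraph.walkWeight]⟩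
    · exact Or.inl (by simp [initState, hv])
  | @tail σ _ _ hstep ih =>
    obtain ⟨u, -, -, -⟩ := hstep
    by_cases huv : G.Adj u v
    · have hd : (scan G u σ).d v = min (σ.d v) (σ.d u + (G.weight u v : ℕ∞)) := by
        simp [scan, huv]
      rw [hd]
      rcases le_total (σ.d v) (σ.d u + (G.weight u v : ℕ∞)) with hle | hle
      · rw [min_eq_left hle]
        exact ih v
      · rw [min_eq_right hle]
        rcases ih u with hu | ⟨p, hp⟩
        · exact Or.inl (by simp [hu])
        · refine Or.inr ⟨p.concat huv, ?_⟩
          have : G.walkWeight (p.concat huv) = G.walkWeight p + G.weight u v := by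
            simp [WeightedGraph.walkWeight, SimpleGraph.Walk.darts_concat]
          rw [this]
          push_cast
          gcongr
    · have hd : (scan G u σ).d v = σ.d v := by simp [scan, huv]
      rw [hd]
      exact ih v

/-- What the search knows about a vertex `v` reached from the source by at most two edges of
weight `1` through the vertex `a`. -/
theorem search_invariant {a v : V} (hsa : s = a ∨ (G.Adj s a ∧ G.weight s a = 1))
    (hav : a = v ∨ (G.Adj a v ∧ G.weight a v = 1)) {σ : State V}
    (hσ : Relation.ReflTransGen (Step G h t) (initState s) σ) :
    (σ = initState s ∨ σ.d a ≤ 1) ∧ (a ∈ σ.scanned → σ.d v ≤ 2) := by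
  induction hσ with
  | refl => exact ⟨Or.inl rfl, fun ha => by simp [initState] at ha⟩
  | @tail σ _ _ hstep ih =>
    obtain ⟨u, -, -, hmin⟩ := hstep
    -- The first scanned vertex must be `s`, as every other key is infinite; relaxing its edges then
    -- reaches `a`.
    have key : σ.d a ≤ 1 ∨ (u = s ∧ σ.d s = 0) := by
      rcases ih.1 with rfl | h1
      · right
        have hu := hmin s (by simp [initState])
        have hs0 : (initState s).d s = 0 := by simp [initState]
        refine ⟨?_, hs0⟩
        by_contra hne
        have hu' : (initState s).d u = ⊤ := by simp [initState, hne]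
        rw [hs0, hu'] at hu
        simp only [top_add, zero_add, top_le_iff] at hu
        exact ENat.natCast_ne_top _ hu
      · exact Or.inl h1
    have hd : (scan G u σ).d a ≤ 1 := by
      rcases key with h1 | ⟨rfl, h0⟩
      · exact (d_scan_le u σ a).trans h1
      · rcases hsa with rfl | ⟨hadj, hw⟩
        · exact (d_scan_le _ _ _).trans (by simp [h0])
        · exact (d_scan_le_of_adj σ hadj).trans (by simp [h0, hw])
    refine ⟨Or.inr hd, fun ha => ?_⟩
    rcases mem_scan_scanned.1 ha with rfl | ha
    · rcases hav with rfl | ⟨hadj, hw⟩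
      · exact hd.trans (by norm_num)
      · refine (d_scan_le_of_adj σ hadj).trans ?_
        rw [hw]
        have h1 : σ.d a ≤ 1 := by
          rcases key with h1 | ⟨rfl, h0⟩
          · exact h1
          · simp [h0]
        calc σ.d a + ((1 : ℕ) : ℕ∞) ≤ 1 + ((1 : ℕ) : ℕ∞) := by gcongr
          _ = 2 := by norm_num
    · exact (d_scan_le _ _ _).trans (ih.2 ha)

/-- A* scans every vertex `v` close to the source whose estimate is too small. -/
theorem mem_of_scans {a v : V} (hsa : s = a ∨ (G.Adj s a ∧ G.weight s a = 1))
    (hav : a = v ∨ (G.Adj a v ∧ G.weight a v = 1)) (hc : G.IsConsistent h)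
    {T : ℕ} (hT : ∀ p : G.toSimpleGraph.Walk s t, T ≤ G.walkWeight p) (hst : s ≠ t)
    (hv : h v t + 2 < T) {S : Finset V} (hS : Scans G h s t S) : v ∈ S := by
  obtain ⟨σ, hσ, htσ, rfl⟩ := hS
  rcases Relation.ReflTransGen.cases_tail hσ with heq | ⟨τ, hτ, hstep⟩
  · rw [heq] at htσ
    simp [initState] at htσ
  -- The last step scans `t`, so in `τ` the key of `t`, which is at least `T`, is minimal among the
  -- unscanned vertices.
  obtain ⟨u, htτ, -, hmin⟩ := hstep
  obtain rfl : t = u := (mem_scan_scanned.1 htσ).resolve_right htτ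
  have hTd : (T : ℕ∞) ≤ τ.d t := by
    rcases exists_walk_le_d hτ t with h1 | ⟨p, hp⟩
    · simp [h1]
    · exact le_trans (by exact_mod_cast hT p) hp
  by_contra hvS
  have hvτ : v ∉ τ.scanned := fun hv' => hvS (mem_scan_scanned.2 (Or.inr hv'))
  obtain ⟨i1, i2⟩ := search_invariant hsa hav hτ
  have bound : ∀ (x : V) (D : ℕ), x ∉ τ.scanned → τ.d x ≤ D → T ≤ D + h x t := by
    intro x D hx hD
    have h1 := hmin x hx
    rw [hc.2 t] at h1
    have : (T : ℕ∞) ≤ (D : ℕ∞) + (h x t : ℕ∞) :=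
      hTd.trans ((le_of_eq (by simp)).trans (h1.trans (by gcongr)))
    exact_mod_cast this
  have ha : h a t ≤ 1 + h v t := by
    rcases hav with rfl | ⟨hadj, hw⟩
    · omega
    · have := hc.1 t _ _ hadj
      omega
  -- If `a` is scanned, `v` itself has a key below `T`; otherwise `a` has one, since consistency
  -- transfers the small estimate from `v` to `a`.
  by_cases haτ : a ∈ τ.scanned
  · have := bound v 2 hvτ (by exact_mod_cast i2 haτ)
    omega
  · rcases i1 with rfl | h1
    · have h1 := hmin s (by simp [initState])
      simp only [initState, hst.symm, if_false, if_true, top_add, zero_add, top_le_iff] at h1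
      exact ENat.natCast_ne_top _ h1
    · have := bound a 1 haτ (by exact_mod_cast h1)
      omega

end Search

/-! ### Counting weight vectors against labels -/

/-- The estimate `x` for a distance within `2` of `2 * M + v` is off by at most `2`. -/
def Near (M x v : ℕ) : Prop := 2 * M + v ≤ x + 2 ∧ x ≤ 2 * M + v + 2

instance (M x v : ℕ) : Decidable (Near M x v) := inferInstanceAs (Decidable (_ ∧ _))

/-- `Near` confines `v` to a window of five integers, contributing at most `5 * M`; the remaining
terms add at most `M`. -/
theorem sum_near_le (M x : ℕ) : ∑ v : Fin M, (if Near M x v then M else 1) ≤ 6 * M := by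
  have hcard : (Finset.univ.filter fun v : Fin M => Near M x v).card ≤ 5 := by
    calc _ = ((Finset.univ.filter fun v : Fin M => Near M x v).image Fin.val).card :=
          (Finset.card_image_of_injective _ Fin.val_injective).symm
      _ ≤ (Finset.Icc (x - 2 * M - 2) (x + 2 - 2 * M)).card := by
          refine Finset.card_le_card fun y hy => ?_
          obtain ⟨v, hv, rfl⟩ := Finset.mem_image.1 hy
          have := (Finset.mem_filter.1 hv).2
          simp only [Near] at this
          rw [Finset.mem_Icc]
          omega
      _ ≤ 5 := by rw [Nat.card_Icc]; omega
  calc ∑ v : Fin M, (if Near M x v then M else 1)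
      ≤ ∑ v : Fin M, ((if Near M x v then M else 0) + 1) :=
        Finset.sum_le_sum fun v _ => by split_ifs <;> omega
    _ = (Finset.univ.filter fun v : Fin M => Near M x v).card * M + M := by
        rw [Finset.sum_add_distrib, ← Finset.sum_filter]; simp
    _ ≤ 5 * M + M := by gcongr
    _ = 6 * M := by ring

/-- Estimates computed from few labels are off for most entries of some weight vector `w`. -/
theorem exists_pow_card_near_le {E I Λ : Type*} [Fintype E] [DecidableEq E] [Fintype I] [Fintype Λ]
    {M : ℕ} (hM : 0 < M) (lab : (E → Fin M) → I → Λ) (est : Λ → E → ℕ) :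
    ∃ w : E → Fin M, ∀ i,
      M ^ (Finset.univ.filter fun e => Near M (est (lab w i) e) (w e)).card ≤
        Fintype.card I * Fintype.card Λ * 6 ^ Fintype.card E := by
  -- For a fixed label `l` this exponential moment is a product over the entries, so its sum over
  -- `w` factorizes.
  have hpow : ∀ (l : Λ) (w : E → Fin M),
      M ^ (Finset.univ.filter fun e => Near M (est l e) (w e)).card =
        ∏ e, if Near M (est l e) (w e) then M else 1 := by
    intro l w
    rw [Finset.prod_ite]
    simp
  have hl : ∀ l : Λ, ∑ w : E → Fin M,
      M ^ (Finset.univ.filter fun e => Near M (est l e) (w e)).card ≤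
        (6 * M) ^ Fintype.card E := by
    intro l
    calc _ = ∑ w : E → Fin M, ∏ e, (if Near M (est l e) (w e) then M else 1) :=
          Finset.sum_congr rfl fun w _ => hpow l w
      _ = ∏ e : E, ∑ v : Fin M, (if Near M (est l e) v then M else 1) := by
          rw [Finset.prod_univ_sum, Fintype.piFinset_univ]
      _ ≤ ∏ _e : E, 6 * M := Finset.prod_le_prod' fun e _ => sum_near_le M _
      _ = (6 * M) ^ Fintype.card E := by simp
  have hsum : ∑ w : E → Fin M, ∑ i,
      M ^ (Finset.univ.filter fun e => Near M (est (lab w i) e) (w e)).card ≤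
      ∑ _w : E → Fin M, Fintype.card I * Fintype.card Λ * 6 ^ Fintype.card E := by
    -- The label depends on `w`; summing over all possible labels removes this dependence at the
    -- cost of a factor `|Λ|`.
    calc _ ≤ ∑ w : E → Fin M, ∑ _i : I, ∑ l : Λ,
            M ^ (Finset.univ.filter fun e => Near M (est l e) (w e)).card :=
          Finset.sum_le_sum fun w _ => Finset.sum_le_sum fun i _ =>
            Finset.single_le_sum
              (f := fun l => M ^ (Finset.univ.filter fun e => Near M (est l e) (w e)).card)
              (fun _ _ => Nat.zero_le _) (Finset.mem_univ (lab w i))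
      _ = Fintype.card I * ∑ l : Λ, ∑ w : E → Fin M,
            M ^ (Finset.univ.filter fun e => Near M (est l e) (w e)).card := by
          rw [Finset.sum_comm (s := (Finset.univ : Finset Λ))]
          simp [Finset.mul_sum]
      _ ≤ Fintype.card I * ∑ _l : Λ, (6 * M) ^ Fintype.card E := by
          gcongr with l
          exact hl l
      _ = _ := by
          simp only [Finset.sum_const, Finset.card_univ, smul_eq_mul, Fintype.card_fun,
            Fintype.card_fin, mul_pow]
          ring
  have : Nonempty (E → Fin M) := ⟨fun _ => ⟨0, hM⟩⟩
  obtain ⟨w, -, hw⟩ := Finset.exists_le_of_sum_le Finset.univ_nonempty hsum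
  exact ⟨w, fun i => (Finset.single_le_sum
    (f := fun i => M ^ (Finset.univ.filter fun e => Near M (est (lab w i) e) (w e)).card)
    (fun _ _ => Nat.zero_le _) (Finset.mem_univ i)).trans hw⟩

/-! ### The lower bound graph and its scanned vertices -/

section Construction

/-- The hub of the vertex `v`, namely its residue modulo `k`. -/
def modHub (n k : ℕ) (v : Fin n) : Fin n := ⟨v % k, (Nat.mod_le _ _).trans_lt v.2⟩

theorem modHub_modHub {n k : ℕ} (v : Fin n) : modHub n k (modHub n k v) = modHub n k v := by
  simp [modHub]

/-- The weights between the hubs, with the entries of `w` between the two halves. -/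
def hubDist {r M : ℕ} (w : Fin r × Fin r → Fin M) (a b : ℕ) : ℕ :=
  if a = b then 0 else 2 * M +
    if h : a < r ∧ b - r < r ∧ r ≤ b then (w (⟨a, h.1⟩, ⟨b - r, h.2.1⟩) : ℕ)
    else if h : b < r ∧ a - r < r ∧ r ≤ a then (w (⟨b, h.1⟩, ⟨a - r, h.2.1⟩) : ℕ) else 0

variable {r M : ℕ} (w : Fin r × Fin r → Fin M)

theorem hubDist_self (a : ℕ) : hubDist w a a = 0 := by simp [hubDist]

theorem hubDist_comm (a b : ℕ) : hubDist w a b = hubDist w b a := by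
  unfold hubDist
  simp only [eq_comm (a := b) (b := a)]
  split_ifs <;> first | rfl | omega

theorem le_hubDist {a b : ℕ} (h : a ≠ b) : 2 * M ≤ hubDist w a b := by
  simp [hubDist, h]

theorem hubDist_le (hM : 0 < M) (a b : ℕ) : hubDist w a b + 1 ≤ 3 * M := by
  unfold hubDist
  split_ifs with _ h1 h2
  · omega
  · have := (w (⟨a, h1.1⟩, ⟨b - r, h1.2.1⟩)).2
    omega
  · have := (w (⟨b, h2.1⟩, ⟨a - r, h2.2.1⟩)).2
    omega
  · omega

/-- Two nonzero weights sum to at least `4 * M`, while a single one is below `3 * M`. -/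
theorem hubDist_triangle (hM : 0 < M) (a b c : ℕ) :
    hubDist w a c ≤ hubDist w a b + hubDist w b c := by
  by_cases hab : a = b
  · subst hab; omega
  by_cases hbc : b = c
  · subst hbc; omega
  have := le_hubDist w hab
  have := le_hubDist w hbc
  have := hubDist_le w hM a c
  omega

theorem hubDist_apply (a b : Fin r) : hubDist w a (r + b) = 2 * M + w (a, b) := by
  have ha := a.2
  have h1 : (a : ℕ) ≠ r + b := by omega
  simp [hubDist, h1]

/-- The lower bound graph with weights `w` between the two halves of the hubs. -/
def lowerBoundGraph (n : ℕ) : WeightedGraph (Fin n) :=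
  hubGraph (modHub n (2 * r)) (fun a b => hubDist w a b) (fun a b => hubDist_comm w a b)

/-- The vertex with index `i` in the cluster of the hub `c`. -/
def clusterVertex (n r : ℕ) (p : Fin (n / (2 * r)) × Fin (2 * r)) : Fin n :=
  Fin.castLE (Nat.div_mul_le_self n (2 * r)) (finProdFinEquiv p)

theorem clusterVertex_injective (n r : ℕ) : Function.Injective (clusterVertex n r) :=
  (Fin.castLE_injective _).comp finProdFinEquiv.injective

theorem modHub_clusterVertex {n : ℕ} (p : Fin (n / (2 * r)) × Fin (2 * r)) :
    (modHub n (2 * r) (clusterVertex n r p) : ℕ) = p.2 := by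
  simp [modHub, clusterVertex, finProdFinEquiv, Nat.mod_eq_of_lt p.2.2]

/-- A vertex in a cluster of the first half. -/
def leftVertex (n r : ℕ) (i : Fin (n / (2 * r))) (a : Fin r) : Fin n :=
  clusterVertex n r (i, ⟨a, by have := a.2; omega⟩)

/-- A vertex in a cluster of the second half. -/
def rightVertex (n r : ℕ) (j : Fin (n / (2 * r))) (b : Fin r) : Fin n :=
  clusterVertex n r (j, ⟨r + b, by have := b.2; omega⟩)

theorem leftVertex_inj {n : ℕ} {i i' : Fin (n / (2 * r))} {a a' : Fin r}
    (h : leftVertex n r i a = leftVertex n r i' a') : i = i' ∧ a = a' := by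
  have := clusterVertex_injective n r h
  simpa [Fin.ext_iff] using this

theorem rightVertex_inj {n : ℕ} {i i' : Fin (n / (2 * r))} {a a' : Fin r}
    (h : rightVertex n r i a = rightVertex n r i' a') : i = i' ∧ a = a' := by
  have := clusterVertex_injective n r h
  simpa [Fin.ext_iff] using this

theorem modHub_leftVertex {n : ℕ} (i : Fin (n / (2 * r))) (a : Fin r) :
    (modHub n (2 * r) (leftVertex n r i a) : ℕ) = a := modHub_clusterVertex _

theorem modHub_rightVertex {n : ℕ} (i : Fin (n / (2 * r))) (a : Fin r) :
    (modHub n (2 * r) (rightVertex n r i a) : ℕ) = r + a := modHub_clusterVertex _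

theorem hubDist_pos (hM : 0 < M) {n : ℕ} (a b : Fin n) (h : a ≠ b) : 0 < hubDist w a b := by
  have := le_hubDist w (Fin.val_ne_of_ne h)
  omega

/-- A* between the clusters of `a` and `b` scans all vertices of the first one whose estimates
are not close to the true distance. -/
theorem mem_of_scans_of_not_near (hM : 0 < M) {n : ℕ} {h : Fin n → Fin n → ℕ}
    (hc : (lowerBoundGraph w n).IsConsistent h) (a b : Fin r) (i i' j : Fin (n / (2 * r)))
    (hnear : ¬ Near M (h (leftVertex n r i' a) (rightVertex n r j b)) (w (a, b)))
    {S : Finset (Fin n)}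
    (hS : Scans (lowerBoundGraph w n) h (leftVertex n r i a) (rightVertex n r j b) S) :
    leftVertex n r i' a ∈ S := by
  have hhub : modHub n (2 * r) (leftVertex n r i' a) = modHub n (2 * r) (leftVertex n r i a) :=
    Fin.ext (by rw [modHub_leftVertex, modHub_leftVertex])
  have hne : ∀ i : Fin (n / (2 * r)), modHub n (2 * r) (leftVertex n r i a) ≠
      modHub n (2 * r) (rightVertex n r j b) := by
    intro i he
    have := congrArg Fin.val he
    rw [modHub_leftVertex, modHub_rightVertex] at this
    have := a.2
    omega
  have hd : ∀ i : Fin (n / (2 * r)), hubDist w (modHub n (2 * r) (leftVertex n r i a))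
      (modHub n (2 * r) (rightVertex n r j b)) = 2 * M + w (a, b) := by
    intro i
    rw [modHub_leftVertex, modHub_rightVertex, hubDist_apply]
  have hup := hubGraph_heuristic_le modHub_modHub (hubDist_pos w hM) hc (hne i')
  simp only [hd] at hup
  -- Consistency excludes overestimates beyond `2`, so failing `Near` can only mean an
  -- underestimate.
  have hlow : h (leftVertex n r i' a) (rightVertex n r j b) + 2 < 2 * M + w (a, b) := by
    by_contra hcon
    exact hnear ⟨by omega, hup⟩
  refine mem_of_scans (a := modHub n (2 * r) (leftVertex n r i a)) (hubGraph_hub_step _) ?_ hc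
    (fun p => ?_) (fun he => hne i (by rw [he])) hlow hS
  · rw [← hhub]
    rcases hubGraph_hub_step (hub := modHub n (2 * r)) (W := fun a b => hubDist w a b)
      (hW := fun a b => hubDist_comm w a b) (leftVertex n r i' a) with h1 | ⟨h1, h2⟩
    · exact Or.inl h1.symm
    · exact Or.inr ⟨h1.symm, by rw [WeightedGraph.weight_symm]; exact h2⟩
  · have := hubGraph_le_walkWeight modHub_modHub (fun a => hubDist_self w a)
      (fun a b c => hubDist_triangle w hM a b c) p
    rwa [hd] at this

/-- If for all indices at most half of the estimates are close, A* scans many vertices. -/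
theorem le_sum_card_scans (hM : 0 < M) {n : ℕ} {h : Fin n → Fin n → ℕ}
    (hc : (lowerBoundGraph w n).IsConsistent h)
    (hnear : ∀ i j : Fin (n / (2 * r)), 2 * (Finset.univ.filter fun e : Fin r × Fin r =>
      Near M (h (leftVertex n r i e.1) (rightVertex n r j e.2)) (w e)).card ≤ r ^ 2)
    {S : Fin n → Fin n → Finset (Fin n)} (hS : ∀ s t, Scans (lowerBoundGraph w n) h s t (S s t)) :
    (n / (2 * r)) ^ 3 * r ^ 2 ≤ 2 * ∑ s, ∑ t, (S s t).card := by
  set m := n / (2 * r) with hm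
  have hfar : ∀ i j : Fin m, r ^ 2 ≤ 2 * (Finset.univ.filter fun e : Fin r × Fin r =>
      ¬ Near M (h (leftVertex n r i e.1) (rightVertex n r j e.2)) (w e)).card := by
    intro i j
    have h1 := hnear i j
    have h2 := Finset.card_filter_add_card_filter_not (s := (Finset.univ : Finset (Fin r × Fin r)))
      (fun e => Near M (h (leftVertex n r i e.1) (rightVertex n r j e.2)) (w e))
    rw [Finset.card_univ, Fintype.card_prod, Fintype.card_fin, ← sq] at h2
    omega
  -- The lower bound does not depend on the source index `i`, which yields the factor `m` in
  -- `hswap`.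
  have hcard : ∀ (a b : Fin r) (i j : Fin m), (Finset.univ.filter fun i' : Fin m =>
      ¬ Near M (h (leftVertex n r i' a) (rightVertex n r j b)) (w (a, b))).card ≤
      (S (leftVertex n r i a) (rightVertex n r j b)).card := by
    intro a b i j
    refine Finset.card_le_card_of_injOn (fun i' => leftVertex n r i' a) ?_ ?_
    · intro i' hi'
      exact mem_of_scans_of_not_near w hM hc a b i i' j (Finset.mem_filter.1 hi').2 (hS _ _)
    · intro i₁ _ i₂ _ he
      exact (leftVertex_inj he).1
  have hinj : Function.Injective fun q : (Fin m × Fin r) × (Fin m × Fin r) =>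
      (leftVertex n r q.1.1 q.1.2, rightVertex n r q.2.1 q.2.2) := by
    rintro ⟨⟨i, a⟩, ⟨j, b⟩⟩ ⟨⟨i', a'⟩, ⟨j', b'⟩⟩ he
    obtain ⟨h1, h2⟩ := Prod.mk.inj he
    obtain ⟨rfl, rfl⟩ := leftVertex_inj h1
    obtain ⟨rfl, rfl⟩ := rightVertex_inj h2
    rfl
  have hsum : ∑ q : (Fin m × Fin r) × (Fin m × Fin r),
      (S (leftVertex n r q.1.1 q.1.2) (rightVertex n r q.2.1 q.2.2)).card ≤
        ∑ s, ∑ t, (S s t).card := by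
    rw [← Fintype.sum_prod_type' (f := fun s t => (S s t).card)]
    rw [← Finset.sum_image (f := fun p : Fin n × Fin n => (S p.1 p.2).card)
      (g := fun q : (Fin m × Fin r) × (Fin m × Fin r) =>
      (leftVertex n r q.1.1 q.1.2, rightVertex n r q.2.1 q.2.2)) hinj.injOn]
    exact Finset.sum_le_sum_of_subset (Finset.subset_univ _)
  have hswap : ∑ q : (Fin m × Fin r) × (Fin m × Fin r), (Finset.univ.filter fun i' : Fin m =>
      ¬ Near M (h (leftVertex n r i' q.1.2) (rightVertex n r q.2.1 q.2.2)) (w (q.1.2, q.2.2))).card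
      = m * ∑ i' : Fin m, ∑ j : Fin m, (Finset.univ.filter fun e : Fin r × Fin r =>
      ¬ Near M (h (leftVertex n r i' e.1) (rightVertex n r j e.2)) (w e)).card := by
    have hcomm : ∀ f : Fin r → Fin m → Fin r → Fin m → ℕ,
        ∑ a, ∑ j, ∑ b, ∑ i', f a j b i' = ∑ i', ∑ j, ∑ a, ∑ b, f a j b i' := by
      intro f
      calc _ = ∑ a, ∑ j, ∑ i', ∑ b, f a j b i' :=
            Finset.sum_congr rfl fun a _ => Finset.sum_congr rfl fun j _ => Finset.sum_comm
        _ = ∑ a, ∑ i', ∑ j, ∑ b, f a j b i' :=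
            Finset.sum_congr rfl fun a _ => Finset.sum_comm
        _ = ∑ i', ∑ a, ∑ j, ∑ b, f a j b i' := Finset.sum_comm
        _ = _ := Finset.sum_congr rfl fun a _ => Finset.sum_comm
    calc _ = ∑ _i : Fin m, ∑ a : Fin r, ∑ j : Fin m, ∑ b : Fin r, ∑ i' : Fin m,
          (if ¬ Near M (h (leftVertex n r i' a) (rightVertex n r j b)) (w (a, b)) then 1
            else 0) := by
          simp only [Finset.card_filter, Fintype.sum_prod_type]
      _ = _ := by
          rw [Finset.sum_const, Finset.card_univ, Fintype.card_fin, smul_eq_mul, hcomm]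
          simp only [Finset.card_filter, Fintype.sum_prod_type]
  calc m ^ 3 * r ^ 2 = m * ∑ _i : Fin m, ∑ _j : Fin m, r ^ 2 := by simp; ring
    _ ≤ m * ∑ i' : Fin m, ∑ j : Fin m, 2 * (Finset.univ.filter fun e : Fin r × Fin r =>
      ¬ Near M (h (leftVertex n r i' e.1) (rightVertex n r j e.2)) (w e)).card :=
        Nat.mul_le_mul_left _ (Finset.sum_le_sum fun i _ => Finset.sum_le_sum fun j _ => hfar i j)
    _ = 2 * ∑ q : (Fin m × Fin r) × (Fin m × Fin r), (Finset.univ.filter fun i' : Fin m =>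
      ¬ Near M (h (leftVertex n r i' q.1.2) (rightVertex n r q.2.1 q.2.2))
        (w (q.1.2, q.2.2))).card := by
        rw [hswap]
        simp only [← Finset.mul_sum]
        ring
    _ ≤ 2 * ∑ s, ∑ t, (S s t).card := Nat.mul_le_mul_left _
        ((Finset.sum_le_sum fun q _ => hcard q.1.2 q.2.2 q.1.1 q.2.1).trans hsum)

end Construction

/-! ### Choice of parameters -/

/-- The counting bound: labels of length `L` carry too little information. -/
theorem label_count_lt {n m r C L κ : ℕ} (hn : 36 < n) (hr : 2 ≤ r) (hm : m ≤ n)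
    (hC : C + 1 ≤ n ^ κ) (hL : 4 * κ * L ≤ r) :
    (m * m * ((C + 1) ^ L) ^ (r + r) * 6 ^ (r * r)) ^ 2 < (n ^ 3) ^ (r ^ 2) := by
  have hn1 : 1 ≤ n := by omega
  -- Squaring accounts for only half of the `r ^ 2` entries being near. Each of the three squared
  -- factors is absorbed by one `n ^ (r ^ 2)`, whence `M = n ^ 3`.
  have h1 : (m * m) ^ 2 ≤ n ^ (r ^ 2) := by
    calc (m * m) ^ 2 ≤ (n * n) ^ 2 := by gcongr
      _ = n ^ 4 := by ring
      _ ≤ n ^ (r ^ 2) := Nat.pow_le_pow_right hn1 (by nlinarith)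
  have h2 : (((C + 1) ^ L) ^ (r + r)) ^ 2 ≤ n ^ (r ^ 2) := by
    calc (((C + 1) ^ L) ^ (r + r)) ^ 2 ≤ (((n ^ κ) ^ L) ^ (r + r)) ^ 2 := by gcongr
      _ = n ^ (4 * κ * L * r) := by
          rw [← pow_mul, ← pow_mul, ← pow_mul]
          congr 1
          ring
      _ ≤ n ^ (r ^ 2) := Nat.pow_le_pow_right hn1 (by nlinarith)
  have h3 : (6 ^ (r * r)) ^ 2 < n ^ (r ^ 2) := by
    calc (6 ^ (r * r)) ^ 2 = 36 ^ (r ^ 2) := by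
          rw [← pow_mul, mul_comm, pow_mul]
          congr 1
          ring
      _ < n ^ (r ^ 2) := Nat.pow_lt_pow_left hn (by positivity)
  calc _ = (m * m) ^ 2 * (((C + 1) ^ L) ^ (r + r)) ^ 2 * (6 ^ (r * r)) ^ 2 := by ring
    _ ≤ n ^ (r ^ 2) * n ^ (r ^ 2) * (6 ^ (r * r)) ^ 2 := by gcongr
    _ < n ^ (r ^ 2) * n ^ (r ^ 2) * n ^ (r ^ 2) := by gcongr
    _ = (n ^ 3) ^ (r ^ 2) := by
        rw [← pow_mul, ← pow_add, ← pow_add]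
        congr 1
        ring

/-- The lower bound for a fixed number `n` of vertices. -/
theorem exists_graph_le_sum_card_scans {n r C L κ : ℕ} (hn : 36 < n) (hr : 2 ≤ r)
    (hC : C + 1 ≤ n ^ κ) (hnC : n ^ 6 ≤ C) (hL : 4 * κ * L ≤ r) (h : LabelingHeuristic n C L)
    (hh : ∀ G : WeightedGraph (Fin n), G.toSimpleGraph.Connected → G.totalWeight ≤ C →
      G.IsConsistent (h.heuristic G)) :
    ∃ G : WeightedGraph (Fin n), G.toSimpleGraph.Connected ∧ G.totalWeight ≤ C ∧
      G.IsCliqueWithLeaves ∧ G.ShortestPathsHaveHopsAtMost 3 ∧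
      ∀ S : Fin n → Fin n → Finset (Fin n), (∀ s t, Scans G (h.heuristic G) s t (S s t)) →
        (n / (2 * r)) ^ 3 * r ^ 2 ≤ 2 * ∑ s, ∑ t, (S s t).card := by
  have hM : 2 ≤ n ^ 3 := by nlinarith [Nat.pow_le_pow_left (show 2 ≤ n by omega) 3]
  have hM0 : 0 < n ^ 3 := by omega
  have : Nonempty (Fin n) := ⟨⟨0, by omega⟩⟩
  -- An index pair selects one vertex per hub; an element of `Λ` collects their `2 * r` labels.
  obtain ⟨w, hw⟩ := exists_pow_card_near_le (E := Fin r × Fin r)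
    (I := Fin (n / (2 * r)) × Fin (n / (2 * r))) (Λ := Fin r ⊕ Fin r → Fin L → Fin (C + 1)) hM0
    (fun w i => Sum.elim (fun a => h.label (lowerBoundGraph w n) (leftVertex n r i.1 a))
      (fun b => h.label (lowerBoundGraph w n) (rightVertex n r i.2 b)))
    (fun l e => (h.est (l (Sum.inl e.1)) (l (Sum.inr e.2)) : ℕ))
  have hconn : (lowerBoundGraph w n).toSimpleGraph.Connected :=
    hubGraph_connected modHub_modHub (hubDist_pos w hM0) (B := 3 * n ^ 3)
      (fun a b => by have := hubDist_le w hM0 a b; omega)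
  have htot : (lowerBoundGraph w n).totalWeight ≤ C := by
    have h1 : (lowerBoundGraph w n).totalWeight ≤ Fintype.card (Fin n) ^ 2 * (3 * n ^ 3) :=
      hubGraph_totalWeight_le (B := 3 * n ^ 3) (by omega)
        (fun a b => by have := hubDist_le w hM0 a b; omega)
    rw [Fintype.card_fin] at h1
    calc _ ≤ n ^ 2 * (3 * n ^ 3) := h1
      _ = 3 * n ^ 5 := by ring
      _ ≤ n * n ^ 5 := Nat.mul_le_mul_right _ (by omega)
      _ = n ^ 6 := by ring
      _ ≤ C := hnC
  refine ⟨lowerBoundGraph w n, hconn, htot,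
    hubGraph_isCliqueWithLeaves modHub_modHub (hubDist_pos w hM0),
    hubGraph_hops modHub_modHub hM0 (fun a b hab => le_hubDist w (Fin.val_ne_of_ne hab))
      (fun a b => by have := hubDist_le w hM0 a b; omega), fun S hS => ?_⟩
  refine le_sum_card_scans w hM0 (hh _ hconn htot) (fun i j => ?_) hS
  have hij := hw (i, j)
  simp only [Sum.elim_inl, Sum.elim_inr, Fintype.card_prod, Fintype.card_fin, Fintype.card_fun,
    Fintype.card_sum] at hij
  by_contra hlt
  have hlt' := label_count_lt (m := n / (2 * r)) hn hr (Nat.div_le_self _ _) hC hL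
  -- More than `r ^ 2 / 2` near entries would make the square of `hij` contradict the counting
  -- bound.
  refine absurd hlt' (not_lt.2 ?_)
  refine le_trans ?_ (Nat.pow_le_pow_left hij 2)
  rw [← pow_mul (n ^ 3) _ 2]
  refine Nat.pow_le_pow_right hM0 ?_
  rw [mul_comm]
  exact (not_le.1 hlt).le

end AStar

theorem mainTheorem1 :
    ∃ (H : ℕ) (c : ℝ), 0 < c ∧
      ∀ (α : ℝ), 0 ≤ α → α ≤ 1 →
      ∀ (C L : ℕ → ℕ),
        (∃ κ : ℕ, ∀ᶠ n in Filter.atTop, C n ≤ n ^ κ) →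
        (∀ᶠ n in Filter.atTop, n ^ 6 ≤ C n) →
        (fun n => (L n : ℝ)) =o[Filter.atTop] (fun n => (n : ℝ) ^ α) →
      ∀ (h : ∀ n, AStar.LabelingHeuristic n (C n) (L n)),
        (∀ (n : ℕ) (G : AStar.WeightedGraph (Fin n)), G.toSimpleGraph.Connected →
          G.totalWeight ≤ C n → G.IsConsistent ((h n).heuristic G)) →
      ∀ᶠ n in Filter.atTop, ∃ G : AStar.WeightedGraph (Fin n),
        G.toSimpleGraph.Connected ∧ G.totalWeight ≤ C n ∧ G.IsCliqueWithLeaves ∧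
        G.ShortestPathsHaveHopsAtMost H ∧
        ∀ S : Fin n → Fin n → Finset (Fin n),
          (∀ s t, AStar.Scans G ((h n).heuristic G) s t (S s t)) →
          c * (n : ℝ) ^ (1 - α) ≤ (∑ s, ∑ t, ((S s t).card : ℝ)) / (n : ℝ) ^ 2 := by
  -- Here `384 = 64 * 3 * 2`: `64` from cubing `n / (4 * r)`, `3` from `r ≤ 3 * y`, and `2` from
  -- half of the estimates being far.
  refine ⟨3, 1 / 384, by norm_num, fun α hα0 hα1 C L ⟨κ, hκ⟩ hnC hL h hh => ?_⟩
  have hε : (0 : ℝ) < 1 / (32 * (κ + 1)) := by positivity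
  filter_upwards [hκ, hnC, hL.bound hε, Filter.eventually_gt_atTop 36] with n h1 h2 h3 hn
  have hn0 : (0 : ℝ) < n := by exact_mod_cast (show 0 < n by omega)
  have hn1 : (1 : ℝ) ≤ n := by exact_mod_cast (show 1 ≤ n by omega)
  have hn36 : (36 : ℝ) < n := by exact_mod_cast hn
  set y : ℝ := (n : ℝ) ^ α with hy
  have hy1 : 1 ≤ y := Real.one_le_rpow hn1 hα0
  have hyn : y ≤ n := by
    calc y ≤ (n : ℝ) ^ (1 : ℝ) := Real.rpow_le_rpow_of_exponent_le hn1 hα1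
      _ = n := Real.rpow_one _
  -- The added `1` secures `2 ≤ r`; the divisor `8` keeps `4 * r ≤ y / 2 + 8 ≤ n`, so rounding in `n
  -- / (2 * r)` loses at most a factor `2`.
  obtain ⟨r, hr⟩ : ∃ r, r = ⌈y / 8⌉₊ + 1 := ⟨_, rfl⟩
  have hceil : y / 8 ≤ ⌈y / 8⌉₊ := Nat.le_ceil _
  have hceil' : (⌈y / 8⌉₊ : ℝ) < y / 8 + 1 := Nat.ceil_lt_add_one (by positivity)
  have hrr : (r : ℝ) = ⌈y / 8⌉₊ + 1 := by rw [hr]; push_cast; rfl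
  have hr2 : 2 ≤ r := by
    have : 0 < ⌈y / 8⌉₊ := Nat.ceil_pos.2 (by positivity)
    omega
  have hLr : 4 * (κ + 1) * L n ≤ r := by
    rw [Real.norm_of_nonneg (by positivity), Real.norm_of_nonneg (by positivity)] at h3
    have : (4 * (κ + 1) * L n : ℝ) ≤ r := by
      calc (4 * (κ + 1) * L n : ℝ) ≤ 4 * (κ + 1) * (1 / (32 * (κ + 1)) * y) := by gcongr
        _ = y / 8 := by field_simp; norm_num
        _ ≤ r := by linarith
    exact_mod_cast this
  have hCn : C n + 1 ≤ n ^ (κ + 1) := by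
    have : 1 ≤ n ^ κ := Nat.one_le_pow _ _ (by omega)
    calc C n + 1 ≤ n ^ κ + n ^ κ := by omega
      _ = n ^ κ * 2 := by ring
      _ ≤ n ^ κ * n := Nat.mul_le_mul_left _ (by omega)
      _ = n ^ (κ + 1) := (pow_succ _ _).symm
  obtain ⟨G, g1, g2, g3, g4, g5⟩ :=
    AStar.exists_graph_le_sum_card_scans hn hr2 hCn h2 hLr (h n) (hh n)
  refine ⟨G, g1, g2, g3, g4, fun S hS => ?_⟩
  have key : (((n / (2 * r) : ℕ) : ℝ)) ^ 3 * (r : ℝ) ^ 2 ≤ 2 * ∑ s, ∑ t, ((S s t).card : ℝ) := by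
    exact_mod_cast g5 S hS
  have hr0 : (0 : ℝ) < r := by exact_mod_cast (show 0 < r by omega)
  have hm : (n : ℝ) / (4 * r) ≤ ((n / (2 * r) : ℕ) : ℝ) := by
    have hlt : (n : ℝ) < 2 * r * ((n / (2 * r) : ℕ) + 1) := by
      exact_mod_cast Nat.lt_mul_div_succ n (show 0 < 2 * r by omega)
    rw [div_le_iff₀ (by positivity)]
    have hle : 4 * (r : ℝ) ≤ n := by linarith
    nlinarith
  have hr3 : (r : ℝ) ≤ 3 * y := by linarith
  have hpow : (n : ℝ) ^ (1 - α) = n / y := by rw [Real.rpow_sub hn0, Real.rpow_one]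
  have hlow : (n : ℝ) ^ 3 / (64 * r) ≤ 2 * ∑ s, ∑ t, ((S s t).card : ℝ) := by
    calc (n : ℝ) ^ 3 / (64 * r) = (n / (4 * r)) ^ 3 * (r : ℝ) ^ 2 := by field_simp; norm_num
      _ ≤ (((n / (2 * r) : ℕ) : ℝ)) ^ 3 * (r : ℝ) ^ 2 := by gcongr
      _ ≤ _ := key
  rw [hpow, le_div_iff₀ (by positivity)]
  calc 1 / 384 * (n / y) * (n : ℝ) ^ 2 = (n : ℝ) ^ 3 / (64 * (3 * y)) / 2 := by
        field_simp; norm_num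
    _ ≤ (n : ℝ) ^ 3 / (64 * r) / 2 := by gcongr
    _ ≤ _ := by linarith
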